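/- Let $f:\mathbb{R}^d\to\mathbb{R}$ be convex and differentiable, minimized at $x_*\in\mathbb{R}^d$, and $L$-smooth for some $L>0$, i.e. $f(y)\le f(x)+\langle\nabla f(x),y-x\rangle+\frac L2\|y-x\|^2$ for all $x,y\in\mathbb{R}^d$. Let $T_1,T_2,\dots$ be the jump times of a Poisson process of rate $1$, i.e. random times such that $T_1,\,T_2-T_1,\,T_3-T_2,\dots$ are independent and exponentially distributed with rate $1$, and put $\mathrm{d}N(t)=\sum_{k\ge1}\delta_{T_k}(\mathrm{d}t)$. For functions $\eta_t,\eta'_t,\gamma_t,\gamma'_t$ of $t\ge 0$ (the value at $t=0$ of a function defined for $t>0$ only being irrelevant) and deterministic points $x_0,z_0\in\mathbb{R}^d$, a solution of $$\mathrm{d}x_t=\eta_t(z_t-x_t)\,\mathrm{d}t-\gamma_t\nabla f(x_t)\,\mathrm{d}N(t),\qquad \mathrm{d}z_t=\eta'_t(x_t-z_t)\,\mathrm{d}t-\gamma'_t\nabla f(x_t)\,\mathrm{d}N(t)$$ started at $(x_0,z_0)$ is a pair of $\mathbb{R}^d$-valued processes $(x_t)_{t\ge0},(z_t)_{t\ge0}$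 such that, almost surely, the paths are càdlàg (right continuous on $[0,\infty)$ with finite left limits $x_{t-},z_{t-}$ at every $t>0$), the integrands below are integrable on $[0,t]$ for every $t\ge0$, and, for all $t\ge0$, $$x_t=x_0+\int_0^t\eta_s(z_s-x_s)\,\mathrm{d}s-\sum_{k:\,T_k\le t}\gamma_{T_k}\nabla f(x_{T_k-}),\qquad z_t=z_0+\int_0^t\eta'_s(x_s-z_s)\,\mathrm{d}s-\sum_{k:\,T_k\le t}\gamma'_{T_k}\nabla f(x_{T_k-}).$$ 1. Let $(x_t,z_t)$ be a solution for the parameters $\eta_t=\frac2t$, $\eta'_t=0$, $\gamma_t=\frac1L$, $\gamma'_t=\frac{t}{2L}$ (the singularity of $\eta_t$ at $t=0$ makes $x_0=z_0$ necessary for a solution to exist). Then, for every $t>0$, $f(x_t)$ is integrable and $$\mathbb{E}f(x_t)-f(x_*)\le\frac{2L\|z_0-x_*\|^2}{t^2}.$$ 2. Assume further that $f$ is $\mu$-strongly convex for some $\mu>0$, i.e. $f(y)\ge f(x)+\langle\nabla f(x),y-x\rangle+\frac\mu2\|y-x\|^2$ for all $x,y\in\mathbb{R}^d$. Let $(x_t,z_t)$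 be a solution for the constant parameters $\eta_t=\eta'_t=\sqrt{\mu/L}$, $\gamma_t=\frac1L$, $\gamma'_t=\frac1{\sqrt{\mu L}}$. Then, for every $t\ge0$, $f(x_t)$ is integrable and $$\mathbb{E}f(x_t)-f(x_*)\le\Big(f(x_0)-f(x_*)+\frac\mu2\|z_0-x_*\|^2\Big)\exp\Big(-\sqrt{\tfrac\mu L}\,t\Big).$$ -/

import Mathlib

open MeasureTheory ProbabilityTheory Filter Topology
open scoped Gradient

noncomputable section

/-- `f` is `L`-smooth: it lies below its quadratic upper models of curvature `L`. -/
def IsLSmooth {d : ℕ} (L : ℝ) (f : EuclideanSpace ℝ (Fin d) → ℝ) : Prop :=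
  ∀ x y : EuclideanSpace ℝ (Fin d),
    f y ≤ f x + inner ℝ (∇ f x) (y - x) + L / 2 * ‖y - x‖ ^ 2

/-- `f` (differentiable) is `μ`-strongly convex: it lies above its quadratic lower models of
curvature `μ`. -/
def IsMuStronglyConvex {d : ℕ} (μ : ℝ) (f : EuclideanSpace ℝ (Fin d) → ℝ) : Prop :=
  ∀ x y : EuclideanSpace ℝ (Fin d),
    f x + inner ℝ (∇ f x) (y - x) + μ / 2 * ‖y - x‖ ^ 2 ≤ f y

/-- The waiting times `T₁, T₂ - T₁, T₃ - T₂, …` of a sequence of times; `T k` in Lean is the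
`(k+1)`-st time `T_{k+1}`. -/
def waitingTime {Ω : Type*} (T : ℕ → Ω → ℝ) : ℕ → Ω → ℝ
  | 0 => T 0
  | k + 1 => fun ω => T (k + 1) ω - T k ω

/-- `T 0, T 1, …` are the successive jump times of a Poisson process of rate `1`: the waiting
times are independent, of exponential law with rate `1`. -/
structure IsPoissonJumpTimes {Ω : Type*} [MeasurableSpace Ω] (P : Measure Ω)
    (T : ℕ → Ω → ℝ) : Prop where
  measurable : ∀ k, Measurable (T k)
  indep : iIndepFun (waitingTime T) P
  law : ∀ k, HasLaw (waitingTime T k) (expMeasure 1) P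

/-- A path `u`, considered at the times `t ≥ 0` only, is càdlàg: it is right continuous and has a
(finite) left limit at every `t > 0`. -/
def IsCadlagPath {E : Type*} [TopologicalSpace E] (u : ℝ → E) : Prop :=
  (∀ t, 0 ≤ t → ContinuousWithinAt u (Set.Ici t) t) ∧
    ∀ t, 0 < t → ∃ l, Tendsto u (𝓝[<] t) (𝓝 l)

/-- The pair of paths `(u, v)`, on the times `t ≥ 0`, solves
`du = η (v - u) dt - γ ∇f(u) dN`, `dv = η' (u - v) dt - γ' ∇f(u) dN`, with `u₀ = x₀`, `v₀ = z₀`,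
where `dN = ∑ₖ δ_{τ k}` for the sequence of times `τ`. The equations are understood in integrated
form, and the gradient at the time `τ k` is taken at the left limit of `u` at `τ k`. -/
structure IsContinuizedPath {d : ℕ} (f : EuclideanSpace ℝ (Fin d) → ℝ) (η η' γ γ' : ℝ → ℝ)
    (τ : ℕ → ℝ) (x₀ z₀ : EuclideanSpace ℝ (Fin d)) (u v : ℝ → EuclideanSpace ℝ (Fin d)) :
    Prop where
  cadlag_fst : IsCadlagPath u
  cadlag_snd : IsCadlagPath v
  integrable_fst : ∀ t, 0 ≤ t → IntervalIntegrable (fun s => η s • (v s - u s)) volume 0 t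
  integrable_snd : ∀ t, 0 ≤ t → IntervalIntegrable (fun s => η' s • (u s - v s)) volume 0 t
  eq_fst : ∀ t, 0 ≤ t → u t = x₀ + (∫ s in (0 : ℝ)..t, η s • (v s - u s))
    - ∑' k, if τ k ≤ t then γ (τ k) • ∇ f (Function.leftLim u (τ k)) else 0
  eq_snd : ∀ t, 0 ≤ t → v t = z₀ + (∫ s in (0 : ℝ)..t, η' s • (u s - v s))
    - ∑' k, if τ k ≤ t then γ' (τ k) • ∇ f (Function.leftLim u (τ k)) else 0

/-- The random processes `x`, `z` follow the continuized iteration driven by the jump times `T`: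
almost surely, their paths are càdlàg and solve the equations. (Such a solution is a
deterministic functional of the jump times up to a null set, so that nothing further has to be
asked about measurability or adaptedness.) -/
def IsContinuizedProcess {d : ℕ} {Ω : Type*} [MeasurableSpace Ω] (P : Measure Ω)
    (f : EuclideanSpace ℝ (Fin d) → ℝ) (η η' γ γ' : ℝ → ℝ) (T : ℕ → Ω → ℝ)
    (x₀ z₀ : EuclideanSpace ℝ (Fin d)) (x z : ℝ → Ω → EuclideanSpace ℝ (Fin d)) : Prop :=
  ∀ᵐ ω ∂P, IsContinuizedPath f η η' γ γ' (fun k => T k ω) x₀ z₀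
    (fun t => x t ω) (fun t => z t ω)

end

/-!
Between two jumps a continuized path solves a linear differential equation with an explicit
solution, and the jumps are explicit too. So the path is a deterministic measurable functional of
the waiting times between the jumps (`IsContinuizedPath.eq_flow_jumpState`), and the claim is about
a piecewise deterministic Markov process: no stochastic calculus is needed.

For such a process let `g r` be the value of a Lyapunov function at time `r` along the flow that
starts at the last jump, and `j r` its value after a jump at time `r`. If `g' + (j - g) ≤ 0`, then
`exp (-w) * g (s + w)` loses at least `exp (-w) * j (s + w)` per unit of time, so that the
expectation over the next exponential waiting time does not exceed `g s`
(`lintegral_jump_or_survive_le`). The independence of the waiting times and a telescoping sum over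
the number of jumps turn this into a bound on the expectation at a fixed time
(`tsum_lintegral_lyapunov_le`). Only nonnegative quantities are integrated, hence the
integrability of `f (x t)` comes out of the bound. There are finitely many jumps before any time
because `exp (-T n)` has a summable expectation (`ae_tendsto_sum_waiting`).

The Lyapunov function is `A (f x - f xstar) + B / 2 ‖z - xstar‖²`, with `A = t² / (4 L)`, `B = 1`
in the convex case, and `A = exp (√(μ / L) t)`, `B = μ A` in the strongly convex case. The
parameters are such that, in `g' + (j - g)`, the decrease of `f` in a gradient step absorbs the
square of the gradient step of `z`, and the scalar products of the gradient combine to one with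
`xstar - x` (`lyapunov_gradientJump_le`); (strong) convexity bounds what is left.
-/

/-! ### Exponential waiting times -/

lemma lintegral_exp_neg_expMeasure :
    ∫⁻ w, ENNReal.ofReal (Real.exp (-w)) ∂(expMeasure 1) = 2⁻¹ := by
  have h1 : expMeasure 1 = volume.withDensity (exponentialPDF 1) := rfl
  have hm : Measurable (exponentialPDF 1) := (measurable_exponentialPDFReal 1).ennreal_ofReal
  rw [h1, lintegral_withDensity_eq_lintegral_mul _ hm (by fun_prop)]
  have h2 : ∀ w : ℝ, (exponentialPDF 1 * fun w => ENNReal.ofReal (Real.exp (-w))) w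
      = 2⁻¹ * exponentialPDF 2 w := by
    intro w
    simp only [Pi.mul_apply, exponentialPDF_eq]
    have : (2⁻¹ : ENNReal) = ENNReal.ofReal 2⁻¹ := by
      rw [ENNReal.ofReal_inv_of_pos (by norm_num)]; simp
    rw [this]
    split_ifs
    · rw [← ENNReal.ofReal_mul (by positivity), ← ENNReal.ofReal_mul (by positivity)]
      congr 1
      rw [show -(2 * w) = -w + -w by ring, Real.exp_add]
      ring_nf
    · simp
  simp_rw [h2]
  have hm2 : Measurable (exponentialPDF 2) := (measurable_exponentialPDFReal 2).ennreal_ofReal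
  rw [lintegral_const_mul _ hm2, lintegral_exponentialPDF_eq_one (by norm_num), mul_one]

lemma ae_pos_expMeasure : ∀ᵐ w ∂(expMeasure 1), 0 < w := by
  have h1 : expMeasure 1 = volume.withDensity (exponentialPDF 1) := rfl
  have hm : Measurable (exponentialPDF 1) := (measurable_exponentialPDFReal 1).ennreal_ofReal
  rw [h1, ae_withDensity_iff hm]
  have : ∀ᵐ w : ℝ, w ≠ 0 := by simp [ae_iff]
  filter_upwards [this] with w hw h
  by_contra hn
  exact h (exponentialPDF_of_neg (lt_of_le_of_ne (not_lt.1 hn) hw))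

section Waiting

variable {Ω : Type*} [MeasurableSpace Ω] {P : Measure Ω} [IsProbabilityMeasure P]
  {W : ℕ → Ω → ℝ}

/-- The expectations of `exp (-(W₀ + ⋯ + Wₙ₋₁))` are the terms `2⁻ⁿ` of a convergent series. -/
lemma ae_tendsto_sum_waiting (hi : iIndepFun W P) (hm : ∀ k, Measurable (W k))
    (hl : ∀ k, HasLaw (W k) (expMeasure 1) P) :
    ∀ᵐ ω ∂P, Tendsto (fun n => ∑ i ∈ Finset.range n, W i ω) atTop atTop := by
  set S : ℕ → Ω → ℝ := fun n ω => ∑ i ∈ Finset.range n, W i ω with hS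
  have hSm : ∀ n, Measurable (S n) := fun n => by fun_prop
  have hE : ∀ n, ∫⁻ ω, ENNReal.ofReal (Real.exp (-S n ω)) ∂P = 2⁻¹ ^ n := by
    intro n
    induction n with
    | zero => simp [hS]
    | succ n ih =>
      have hind : IndepFun (S n) (W n) P := by
        have := hi.indepFun_sum_range_succ hm n
        convert this using 1
        ext ω
        simp [hS]
      have hind2 := hind.comp (φ := fun x => ENNReal.ofReal (Real.exp (-x)))
        (ψ := fun x => ENNReal.ofReal (Real.exp (-x))) (by fun_prop) (by fun_prop)
      have hmul := lintegral_mul_eq_lintegral_mul_lintegral_of_indepFun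
        (f := (fun x => ENNReal.ofReal (Real.exp (-x))) ∘ S n)
        (g := (fun x => ENNReal.ofReal (Real.exp (-x))) ∘ W n)
        (by have := hSm n; fun_prop) (by have := hm n; fun_prop) hind2
      have hw : ∫⁻ ω, ENNReal.ofReal (Real.exp (-W n ω)) ∂P = 2⁻¹ := by
        rw [← lintegral_exp_neg_expMeasure, ← (hl n).map_eq,
          lintegral_map (by fun_prop) (hm n)]
      rw [pow_succ, ← ih, ← hw]
      simp only [Function.comp_apply] at hmul
      rw [← hmul]
      refine lintegral_congr fun ω => ?_
      simp only [Pi.mul_apply, Function.comp_apply]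
      rw [← ENNReal.ofReal_mul (by positivity), ← Real.exp_add]
      congr 2
      simp only [hS, Finset.sum_range_succ]
      ring
  have hsum : ∫⁻ ω, ∑' n, ENNReal.ofReal (Real.exp (-S n ω)) ∂P ≠ ⊤ := by
    rw [lintegral_tsum (fun n => by have := hSm n; fun_prop)]
    simp_rw [hE]
    rw [ENNReal.tsum_geometric]
    simp
  have hae := ae_lt_top' (by
    exact AEMeasurable.tsum (fun n => by have := hSm n; fun_prop)) hsum
  filter_upwards [hae] with ω hω
  have h0 := ENNReal.tendsto_atTop_zero_of_tsum_ne_top hω.ne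
  have h1 : Tendsto (fun n => Real.exp (-S n ω)) atTop (𝓝 0) := by
    have := (ENNReal.tendsto_toReal ENNReal.zero_ne_top).comp h0
    simpa [Function.comp_def, ENNReal.toReal_ofReal (Real.exp_pos _).le] using this
  have h2 := Real.tendsto_exp_comp_nhds_zero.1 h1
  simpa [Function.comp_def, hS] using tendsto_neg_atBot_atTop.comp h2

end Waiting

/-! ### One step of a supermartingale between exponential jumps -/

/-- If `g' + (j - g) ≤ 0` on `(s, t)`, then `exp (-w) * g (s + w)` decreases at least as fast as
`exp (-w) * j (s + w)` accumulates. -/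
lemma lintegral_jump_or_survive_le {s t : ℝ} (hst : s ≤ t) {g g' j : ℝ → ℝ}
    (hc : ContinuousOn g (Set.Icc s t)) (hd : ∀ r ∈ Set.Ioo s t, HasDerivAt g (g' r) r)
    (hj : Measurable j) (hj0 : ∀ r ∈ Set.Icc s t, 0 ≤ j r) (hgt : 0 ≤ g t)
    (hle : ∀ r ∈ Set.Ioo s t, j r ≤ g r - g' r) :
    ∫⁻ w, (if s + w ≤ t then ENNReal.ofReal (j (s + w)) else ENNReal.ofReal (g t))
      ∂(expMeasure 1) ≤ ENNReal.ofReal (g s) := by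
  have h1 : expMeasure 1 = volume.withDensity (exponentialPDF 1) := rfl
  have hm : Measurable (exponentialPDF 1) := (measurable_exponentialPDFReal 1).ennreal_ofReal
  have hmF : Measurable (fun w => if s + w ≤ t then ENNReal.ofReal (j (s + w))
      else ENNReal.ofReal (g t)) :=
    Measurable.ite (measurableSet_le (by fun_prop) (by fun_prop)) (by fun_prop) (by fun_prop)
  set G : ℝ → ℝ := fun w => -(Real.exp (-w) * g (s + w)) with hG
  set G' : ℝ → ℝ := fun w => Real.exp (-w) * (g (s + w) - g' (s + w)) with hG'
  set ψ : ℝ → ℝ := fun w => Real.exp (-w) * j (s + w) with hψ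
  have hGc : ContinuousOn G (Set.Icc 0 (t - s)) := by
    refine (ContinuousOn.mul (by fun_prop) (hc.comp (by fun_prop) ?_)).neg
    intro w hw
    constructor <;> linarith [hw.1, hw.2]
  have hGd : ∀ w ∈ Set.Ioo 0 (t - s), HasDerivAt G (G' w) w := by
    intro w hw
    have hgd := hd (s + w) ⟨by linarith [hw.1], by linarith [hw.2]⟩
    have e1 : HasDerivAt (fun w => g (s + w)) (g' (s + w)) w := by
      simpa using hgd.comp_const_add s w
    have e2 : HasDerivAt (fun w : ℝ => Real.exp (-w)) (-Real.exp (-w)) w := by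
      simpa using (hasDerivAt_neg w).exp
    convert! (e2.mul e1).neg using 1
    simp only [hG']
    ring
  have hψG : ∀ w ∈ Set.Ioo 0 (t - s), ψ w ≤ G' w := by
    intro w hw
    exact mul_le_mul_of_nonneg_left (hle _ ⟨by linarith [hw.1], by linarith [hw.2]⟩)
      (Real.exp_pos _).le
  have hψ0 : ∀ w ∈ Set.Icc 0 (t - s), 0 ≤ ψ w := by
    intro w hw
    exact mul_nonneg (Real.exp_pos _).le (hj0 _ ⟨by linarith [hw.1], by linarith [hw.2]⟩)
  have hG'int : IntegrableOn G' (Set.Ioo 0 (t - s)) := by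
    rw [← integrableOn_Ioc_iff_integrableOn_Ioo]
    exact intervalIntegral.integrableOn_deriv_of_nonneg hGc hGd
      fun w hw => (hψ0 w ⟨hw.1.le, hw.2.le⟩).trans (hψG w hw)
  have hψint : IntegrableOn ψ (Set.Icc 0 (t - s)) := by
    rw [integrableOn_Icc_iff_integrableOn_Ioo]
    refine Integrable.mono' hG'int (by simp only [hψ]; fun_prop) ?_
    refine (ae_restrict_iff' measurableSet_Ioo).2 (ae_of_all _ fun w hw => ?_)
    rw [Real.norm_of_nonneg (hψ0 w ⟨hw.1.le, hw.2.le⟩)]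
    exact hψG w hw
  have hmain : ∫ w in (0 : ℝ)..(t - s), ψ w ≤ G (t - s) - G 0 :=
    intervalIntegral.integral_le_sub_of_hasDeriv_right_of_le (by linarith) hGc
      (fun w hw => (hGd w hw).hasDerivWithinAt) hψint hψG
  -- the event of a jump before the horizon
  have hA : ∫⁻ w in Set.Iic (t - s), (if s + w ≤ t then ENNReal.ofReal (j (s + w))
      else ENNReal.ofReal (g t)) ∂(expMeasure 1)
      = ENNReal.ofReal (∫ w in (0 : ℝ)..(t - s), ψ w) := by
    rw [intervalIntegral.integral_of_le (by linarith), ← integral_Icc_eq_integral_Ioc,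
      ofReal_integral_eq_lintegral_ofReal hψint
        ((ae_restrict_iff' measurableSet_Icc).2 (ae_of_all _ hψ0)),
      h1, setLIntegral_withDensity_eq_setLIntegral_mul _ hm hmF measurableSet_Iic,
      ← lintegral_indicator measurableSet_Iic, ← lintegral_indicator measurableSet_Icc]
    refine lintegral_congr fun w => ?_
    by_cases hw1 : w ≤ t - s
    · by_cases hw0 : 0 ≤ w
      · rw [Set.indicator_of_mem (show w ∈ Set.Iic (t - s) from hw1),
          Set.indicator_of_mem (show w ∈ Set.Icc 0 (t - s) from ⟨hw0, hw1⟩), Pi.mul_apply,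
          if_pos (by linarith), exponentialPDF_of_nonneg hw0,
          ← ENNReal.ofReal_mul (by positivity)]
        simp [hψ]
      · rw [Set.indicator_of_mem (show w ∈ Set.Iic (t - s) from hw1),
          Set.indicator_of_notMem (fun h : w ∈ Set.Icc 0 (t - s) => hw0 h.1), Pi.mul_apply,
          exponentialPDF_of_neg (not_le.1 hw0), zero_mul]
    · rw [Set.indicator_of_notMem (fun h : w ∈ Set.Iic (t - s) => hw1 h),
        Set.indicator_of_notMem (fun h : w ∈ Set.Icc 0 (t - s) => hw1 h.2)]
  -- the event of no jump before the horizon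
  have hB : ∫⁻ w in (Set.Iic (t - s))ᶜ, (if s + w ≤ t then ENNReal.ofReal (j (s + w))
      else ENNReal.ofReal (g t)) ∂(expMeasure 1)
      = ENNReal.ofReal (Real.exp (-(t - s)) * g t) := by
    have := isProbabilityMeasure_expMeasure (r := 1) one_pos
    rw [setLIntegral_congr_fun (g := fun _ => ENNReal.ofReal (g t)) measurableSet_Iic.compl
      (fun w hw => if_neg (fun h => hw (by simp only [Set.mem_Iic]; linarith))),
      setLIntegral_const, prob_compl_eq_one_sub measurableSet_Iic, mul_comm,
      ENNReal.ofReal_mul (Real.exp_pos _).le]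
    congr 1
    rw [h1, withDensity_apply _ measurableSet_Iic, lintegral_exponentialPDF_eq_antiDeriv one_pos,
      if_pos (by linarith), ← ENNReal.ofReal_one, ← ENNReal.ofReal_sub _
        (by simpa using hst)]
    congr 1
    simp
  rw [← lintegral_add_compl _ (measurableSet_Iic (a := t - s)), hA, hB,
    ← ENNReal.ofReal_add]
  · refine ENNReal.ofReal_le_ofReal ?_
    have e : G (t - s) - G 0 = g s - Real.exp (-(t - s)) * g t := by
      simp only [hG]
      simp
      ring
    linarith
  · exact intervalIntegral.integral_nonneg (by linarith) hψ0
  · positivity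

/-! ### Piecewise deterministic processes -/

section PiecewiseDeterministic

variable {Y : Type*} {φ : ℝ → ℝ → Y → Y} {J : ℝ → Y → Y} {y₀ : Y}

/-- The time and the state just after the `n`-th jump of the process that starts at time `0` in
`y₀`, is carried from time `s` to time `r` by the flow `φ s r` between jumps, and from which a
jump at time `r` is made by `J r`; `w` is the sequence of the waiting times between jumps. The
`0`-th jump is the start. -/
def jumpState (φ : ℝ → ℝ → Y → Y) (J : ℝ → Y → Y) (y₀ : Y) (w : ℕ → ℝ) : ℕ → ℝ × Y
  | 0 => (0, y₀)
  | n + 1 => ((jumpState φ J y₀ w n).1 + w n,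
      J ((jumpState φ J y₀ w n).1 + w n)
        (φ (jumpState φ J y₀ w n).1 ((jumpState φ J y₀ w n).1 + w n) (jumpState φ J y₀ w n).2))

lemma jumpState_fst (w : ℕ → ℝ) (n : ℕ) :
    (jumpState φ J y₀ w n).1 = ∑ i ∈ Finset.range n, w i := by
  induction n with
  | zero => rfl
  | succ n ih => rw [Finset.sum_range_succ, ← ih]; rfl

lemma jumpState_congr {w w' : ℕ → ℝ} {n : ℕ} (h : ∀ i < n, w i = w' i) :
    jumpState φ J y₀ w n = jumpState φ J y₀ w' n := by
  induction n with
  | zero => rfl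
  | succ n ih => simp only [jumpState, ih fun i hi => h i (by omega), h n (by omega)]

variable [MeasurableSpace Y]

lemma measurable_jumpState (hφ : Measurable fun q : ℝ × ℝ × Y => φ q.1 q.2.1 q.2.2)
    (hJ : Measurable fun q : ℝ × Y => J q.1 q.2) (n : ℕ) :
    Measurable fun w => jumpState φ J y₀ w n := by
  induction n with
  | zero => exact measurable_const
  | succ n ih =>
    have h1 : Measurable fun w : ℕ → ℝ => (jumpState φ J y₀ w n).1 + w n :=
      ih.fst.add (measurable_pi_apply n)
    exact h1.prodMk (hJ.comp (h1.prodMk (hφ.comp (ih.fst.prodMk (h1.prodMk ih.snd)))))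

variable {Ω : Type*} [MeasurableSpace Ω] {P : Measure Ω} {W : ℕ → Ω → ℝ}

lemma indepFun_jumpState (hφ : Measurable fun q : ℝ × ℝ × Y => φ q.1 q.2.1 q.2.2)
    (hJ : Measurable fun q : ℝ × Y => J q.1 q.2) (hi : iIndepFun W P)
    (hm : ∀ k, Measurable (W k)) (n : ℕ) :
    IndepFun (fun ω => jumpState φ J y₀ (fun k => W k ω) n) (W n) P := by
  have h := hi.indepFun_finset (Finset.range n) {n} (by simp) hm
  have hA : Measurable fun r : Finset.range n → ℝ => jumpState φ J y₀
      (fun k => if hk : k ∈ Finset.range n then r ⟨k, hk⟩ else 0) n := by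
    refine (measurable_jumpState hφ hJ n).comp (measurable_pi_lambda _ fun k => ?_)
    split_ifs
    · exact measurable_pi_apply _
    · exact measurable_const
  have hB : Measurable fun r : ({n} : Finset ℕ) → ℝ => r ⟨n, by simp⟩ := measurable_pi_apply _
  have hfun : (fun ω => jumpState φ J y₀ (fun k => W k ω) n) = (fun r : Finset.range n → ℝ =>
      jumpState φ J y₀ (fun k => if hk : k ∈ Finset.range n then r ⟨k, hk⟩ else 0) n) ∘
        fun ω i => W i ω := by
    ext1 ω
    exact jumpState_congr fun i hi => by simp [hi]
  rw [hfun]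
  exact h.comp hA hB

variable [IsProbabilityMeasure P]

/-- Let `V` be a function of time and state such that, along the flow, the generator
`g' + (V after a jump - g)` of the process is nonpositive, where `g` is `V` along the flow. Then
the expectation of `V` at the time `t`, here split according to the number `n` of jumps before
`t`, is at most the initial value of `V`. -/
theorem tsum_lintegral_lyapunov_le
    (hφ : Measurable fun q : ℝ × ℝ × Y => φ q.1 q.2.1 q.2.2)
    (hJ : Measurable fun q : ℝ × Y => J q.1 q.2) (hi : iIndepFun W P)
    (hm : ∀ k, Measurable (W k)) (hl : ∀ k, HasLaw (W k) (expMeasure 1) P)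
    (hW : ∀ᵐ ω ∂P, ∀ k, 0 < W k ω)
    {V : ℝ → Y → ℝ} (hV : Measurable fun q : ℝ × Y => V q.1 q.2)
    (hV0 : ∀ r y, 0 ≤ r → 0 ≤ V r y) (hVs : ∀ s y, 0 ≤ s → V s (φ s s y) ≤ V s y)
    (hc : ∀ s y, 0 ≤ s → ContinuousOn (fun r => V r (φ s r y)) (Set.Ici s))
    (hd : ∀ s y, 0 ≤ s → ∃ g' : ℝ → ℝ, ∀ r, s < r →
      HasDerivAt (fun r => V r (φ s r y)) (g' r) r ∧
        V r (J r (φ s r y)) ≤ V r (φ s r y) - g' r)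
    {t : ℝ} (ht : 0 ≤ t) :
    ∑' n, ∫⁻ ω, (if (jumpState φ J y₀ (fun k => W k ω) n).1 ≤ t ∧
          t < (jumpState φ J y₀ (fun k => W k ω) (n + 1)).1 then
        ENNReal.ofReal (V t (φ (jumpState φ J y₀ (fun k => W k ω) n).1 t
          (jumpState φ J y₀ (fun k => W k ω) n).2)) else 0) ∂P
      ≤ ENNReal.ofReal (V 0 y₀) := by
  set S : ℕ → Ω → ℝ × Y := fun n ω => jumpState φ J y₀ (fun k => W k ω) n with hS
  have hSm : ∀ n, Measurable (S n) := fun n =>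
    (measurable_jumpState hφ hJ n).comp (measurable_pi_lambda _ hm)
  have hS1 : ∀ n ω, (S (n + 1) ω).1 = (S n ω).1 + W n ω := fun _ _ => rfl
  have hS2 : ∀ n ω, (S (n + 1) ω).2 =
    J ((S n ω).1 + W n ω) (φ (S n ω).1 ((S n ω).1 + W n ω) (S n ω).2) := fun _ _ => rfl
  set b : ℕ → Ω → ENNReal := fun n ω => if (S n ω).1 ≤ t ∧ t < (S (n + 1) ω).1 then
    ENNReal.ofReal (V t (φ (S n ω).1 t (S n ω).2)) else 0 with hb
  set a : ℕ → Ω → ENNReal := fun n ω => if (S n ω).1 ≤ t then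
    ENNReal.ofReal (V (S n ω).1 (S n ω).2) else 0 with ha
  have ham : ∀ n, Measurable (a n) := fun n =>
    Measurable.ite (measurableSet_le (hSm n).fst measurable_const)
      (hV.comp (hSm n)).ennreal_ofReal measurable_const
  have hpos : ∀ᵐ ω ∂P, ∀ n, 0 ≤ (S n ω).1 := by
    filter_upwards [hW] with ω hω n
    simp only [hS, jumpState_fst]
    exact Finset.sum_nonneg fun i _ => (hω i).le
  -- the value after the next jump, or at the horizon if that comes first
  set h : (ℝ × Y) × ℝ → ENNReal := fun q => if q.1.1 ≤ t then
    (if q.1.1 + q.2 ≤ t then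
      ENNReal.ofReal (V (q.1.1 + q.2) (J (q.1.1 + q.2) (φ q.1.1 (q.1.1 + q.2) q.1.2)))
      else ENNReal.ofReal (V t (φ q.1.1 t q.1.2))) else 0 with hh
  have hhm : Measurable h := by
    have m1 : Measurable fun q : (ℝ × Y) × ℝ => q.1.1 + q.2 := by fun_prop
    have m2 : Measurable fun q : (ℝ × Y) × ℝ => φ q.1.1 (q.1.1 + q.2) q.1.2 :=
      hφ.comp (measurable_fst.fst.prodMk (m1.prodMk measurable_fst.snd))
    have m3 : Measurable fun q : (ℝ × Y) × ℝ => φ q.1.1 t q.1.2 :=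
      hφ.comp (measurable_fst.fst.prodMk (measurable_const.prodMk measurable_fst.snd))
    exact Measurable.ite (measurableSet_le measurable_fst.fst measurable_const)
      (Measurable.ite (measurableSet_le m1 measurable_const)
        (hV.comp (m1.prodMk (hJ.comp (m1.prodMk m2)))).ennreal_ofReal
        (hV.comp (measurable_const.prodMk m3)).ennreal_ofReal) measurable_const
  have hstep : ∀ n, ∫⁻ ω, a (n + 1) ω ∂P + ∫⁻ ω, b n ω ∂P ≤ ∫⁻ ω, a n ω ∂P := by
    intro n
    have hprod : P.map (fun ω => (S n ω, W n ω)) = (P.map (S n)).prod (expMeasure 1) := by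
      rw [(indepFun_jumpState hφ hJ hi hm n).map_prod_eq_prod_map_map (hSm n).aemeasurable
        (hm n).aemeasurable, (hl n).map_eq]
    have : IsProbabilityMeasure (expMeasure 1) := isProbabilityMeasure_expMeasure one_pos
    calc ∫⁻ ω, a (n + 1) ω ∂P + ∫⁻ ω, b n ω ∂P
        = ∫⁻ ω, (a (n + 1) ω + b n ω) ∂P := (lintegral_add_left (ham _) _).symm
      _ ≤ ∫⁻ ω, h (S n ω, W n ω) ∂P := by
          refine lintegral_mono_ae ?_
          filter_upwards [hW] with ω hω
          have := hω n
          simp only [ha, hb, hh, hS1, hS2]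
          by_cases h1 : (S n ω).1 + W n ω ≤ t
          · rw [if_pos h1, if_neg (by rintro ⟨-, h⟩; linarith), if_pos (by linarith),
              if_pos h1, add_zero]
          · by_cases h2 : (S n ω).1 ≤ t
            · rw [if_neg h1, if_pos ⟨h2, not_le.1 h1⟩, if_pos h2, if_neg h1, zero_add]
            · rw [if_neg h1, if_neg (fun h => h2 h.1), if_neg h2, zero_add]
      _ = ∫⁻ ω, ∫⁻ w, h (S n ω, w) ∂(expMeasure 1) ∂P := by
          rw [← lintegral_map hhm ((hSm n).prodMk (hm n)), hprod,
            lintegral_prod _ hhm.aemeasurable,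
            lintegral_map (hhm.lintegral_prod_right') (hSm n)]
      _ ≤ ∫⁻ ω, a n ω ∂P := by
          refine lintegral_mono_ae ?_
          filter_upwards [hpos] with ω hω
          have hs := hω n
          by_cases h2 : (S n ω).1 ≤ t
          · obtain ⟨g', hg'⟩ := hd (S n ω).1 (S n ω).2 hs
            simp only [ha, hh, if_pos h2]
            refine (lintegral_jump_or_survive_le h2
              (g := fun r => V r (φ (S n ω).1 r (S n ω).2)) (g' := g')
              (j := fun r => V r (J r (φ (S n ω).1 r (S n ω).2)))
              ((hc _ _ hs).mono Set.Icc_subset_Ici_self) (fun r hr => (hg' r hr.1).1) ?_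
              (fun r hr => hV0 _ _ (hs.trans hr.1)) (hV0 _ _ ht)
              (fun r hr => (hg' r hr.1).2)).trans ?_
            · exact hV.comp (measurable_id.prodMk (hJ.comp (measurable_id.prodMk
                (hφ.comp (measurable_const.prodMk (measurable_id.prodMk measurable_const))))))
            · exact ENNReal.ofReal_le_ofReal (hVs _ _ hs)
          · simp [hh, h2]
  have hpart : ∀ n, ∫⁻ ω, a n ω ∂P + ∑ k ∈ Finset.range n, ∫⁻ ω, b k ω ∂P
      ≤ ENNReal.ofReal (V 0 y₀) := by
    intro n
    induction n with
    | zero => simp [ha, hS, jumpState, ht]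
    | succ n ih =>
      refine le_trans ?_ ih
      rw [Finset.sum_range_succ, add_comm (∑ k ∈ Finset.range n, _), ← add_assoc]
      gcongr
      exact hstep n
  rw [ENNReal.tsum_eq_iSup_nat]
  exact iSup_le fun n => le_add_self.trans (hpart n)

/-- The expectation bound for a nonnegative function `F` of the state which a Lyapunov function
`V` of the process dominates, up to the factor `c`, at time `t`. -/
theorem integrable_and_integral_le_of_lyapunov
    (hφ : Measurable fun q : ℝ × ℝ × Y => φ q.1 q.2.1 q.2.2)
    (hJ : Measurable fun q : ℝ × Y => J q.1 q.2) (hi : iIndepFun W P)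
    (hm : ∀ k, Measurable (W k)) (hl : ∀ k, HasLaw (W k) (expMeasure 1) P)
    (hW : ∀ᵐ ω ∂P, ∀ k, 0 < W k ω)
    {V : ℝ → Y → ℝ} (hV : Measurable fun q : ℝ × Y => V q.1 q.2)
    (hV0 : ∀ r y, 0 ≤ r → 0 ≤ V r y) (hVs : ∀ s y, 0 ≤ s → V s (φ s s y) ≤ V s y)
    (hc : ∀ s y, 0 ≤ s → ContinuousOn (fun r => V r (φ s r y)) (Set.Ici s))
    (hd : ∀ s y, 0 ≤ s → ∃ g' : ℝ → ℝ, ∀ r, s < r →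
      HasDerivAt (fun r => V r (φ s r y)) (g' r) r ∧
        V r (J r (φ s r y)) ≤ V r (φ s r y) - g' r)
    {t : ℝ} (ht : 0 ≤ t) {F : Y → ℝ} (hF : Measurable F) (hF0 : ∀ y, 0 ≤ F y)
    {c : ℝ} (hcpos : 0 < c) (hFV : ∀ y, c * F y ≤ V t y) {X : Ω → Y}
    (hX : ∀ᵐ ω ∂P, ∀ n, (jumpState φ J y₀ (fun k => W k ω) n).1 ≤ t →
      t < (jumpState φ J y₀ (fun k => W k ω) (n + 1)).1 →
      X ω = φ (jumpState φ J y₀ (fun k => W k ω) n).1 t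
        (jumpState φ J y₀ (fun k => W k ω) n).2) :
    Integrable (fun ω => F (X ω)) P ∧ ∫ ω, F (X ω) ∂P ≤ V 0 y₀ / c := by
  set S : ℕ → Ω → ℝ × Y := fun n ω => jumpState φ J y₀ (fun k => W k ω) n with hS
  have hSm : ∀ n, Measurable (S n) := fun n =>
    (measurable_jumpState hφ hJ n).comp (measurable_pi_lambda _ hm)
  set q : ℕ → Ω → ENNReal := fun n ω => if (S n ω).1 ≤ t ∧ t < (S (n + 1) ω).1 then
    ENNReal.ofReal (F (φ (S n ω).1 t (S n ω).2)) else 0 with hq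
  have hqm : ∀ n, Measurable (q n) := fun n =>
    Measurable.ite ((measurableSet_le (hSm n).fst measurable_const).inter
      (measurableSet_lt measurable_const (hSm (n + 1)).fst))
      (hF.comp (hφ.comp ((hSm n).fst.prodMk
        (measurable_const.prodMk (hSm n).snd)))).ennreal_ofReal measurable_const
  have hQm : Measurable fun ω => ∑' n, q n ω := Measurable.tsum hqm
  have hle : ENNReal.ofReal c * ∫⁻ ω, ∑' n, q n ω ∂P ≤ ENNReal.ofReal (V 0 y₀) := by
    refine le_trans ?_ (tsum_lintegral_lyapunov_le (y₀ := y₀) hφ hJ hi hm hl hW hV hV0 hVs hc hd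
      ht)
    rw [lintegral_tsum (fun n => (hqm n).aemeasurable), ← ENNReal.tsum_mul_left]
    refine ENNReal.tsum_le_tsum fun n => ?_
    rw [← lintegral_const_mul _ (hqm n)]
    refine lintegral_mono fun ω => ?_
    simp only [hq, hS]
    split_ifs
    · rw [← ENNReal.ofReal_mul hcpos.le]
      exact ENNReal.ofReal_le_ofReal (hFV _)
    · simp
  -- almost surely, `t` lies in exactly one of the intervals between successive jumps
  have hEq : ∀ᵐ ω ∂P, ∑' n, q n ω = ENNReal.ofReal (F (X ω)) := by
    filter_upwards [hX, hW, ae_tendsto_sum_waiting hi hm hl] with ω hXω hWω hTω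
    have hS1 : ∀ n, (S n ω).1 = ∑ i ∈ Finset.range n, W i ω := fun n => jumpState_fst _ _
    have hmono : StrictMono fun n => (S n ω).1 := strictMono_nat_of_lt_succ fun n => by
      simp only [hS1, Finset.sum_range_succ]
      linarith [hWω n]
    obtain ⟨N, hN⟩ := (hTω.eventually_gt_atTop t).exists
    have hex : ∃ n, t < (S n ω).1 := ⟨N, by rw [hS1]; exact hN⟩
    classical
    obtain ⟨m, hm1⟩ : ∃ m, Nat.find hex = m + 1 := Nat.exists_eq_succ_of_ne_zero (by
      intro h0
      have := Nat.find_spec hex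
      rw [h0, hS1] at this
      simp at this
      linarith)
    have hlt : t < (S (m + 1) ω).1 := hm1 ▸ Nat.find_spec hex
    have hmle : (S m ω).1 ≤ t := not_lt.1 (Nat.find_min hex (by omega))
    rw [tsum_eq_single m]
    · simp only [hq]
      rw [if_pos ⟨hmle, hlt⟩, hXω m hmle hlt]
    · intro k hk
      simp only [hq]
      refine if_neg ?_
      rintro ⟨h1, h2⟩
      have e1 := hmono.lt_iff_lt.1 (h1.trans_lt hlt)
      have e2 := hmono.lt_iff_lt.1 (hmle.trans_lt h2)
      omega
  have hFX : ∀ᵐ ω ∂P, (∑' n, q n ω).toReal = F (X ω) := by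
    filter_upwards [hEq] with ω hω
    rw [hω, ENNReal.toReal_ofReal (hF0 _)]
  have hfin : ∫⁻ ω, ∑' n, q n ω ∂P ≤ ENNReal.ofReal (V 0 y₀ / c) := by
    rw [ENNReal.ofReal_div_of_pos hcpos, ENNReal.le_div_iff_mul_le (by simp [hcpos]) (by simp),
      mul_comm]
    exact hle
  have hV00 : 0 ≤ V 0 y₀ / c := div_nonneg (hV0 _ _ le_rfl) hcpos.le
  have hne : ∫⁻ ω, ∑' n, q n ω ∂P ≠ ⊤ := ne_top_of_le_ne_top ENNReal.ofReal_ne_top hfin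
  refine ⟨(integrable_toReal_of_lintegral_ne_top hQm.aemeasurable hne).congr hFX, ?_⟩
  rw [← integral_congr_ae hFX, integral_toReal hQm.aemeasurable (ae_lt_top hQm hne)]
  exact ENNReal.toReal_le_of_le_ofReal hV00 hfin

end PiecewiseDeterministic

/-! ### Paths between and at the jumps -/

section Increments

variable {E : Type*} [NormedAddCommGroup E]

lemma sum_jumps_eq {s : ℕ → ℝ} (hs : StrictMono s) (g : ℕ → E) {n : ℕ} {t : ℝ}
    (h1 : s n ≤ t) (h2 : t < s (n + 1)) :
    (∑' k, if s (k + 1) ≤ t then g k else 0) = ∑ k ∈ Finset.range n, g k := by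
  have hk : ∀ k, s (k + 1) ≤ t ↔ k < n := fun k => by
    constructor
    · intro h
      have := hs.lt_iff_lt.1 (h.trans_lt h2)
      omega
    · intro h
      exact (hs.monotone (by omega)).trans h1
  rw [tsum_eq_sum (s := Finset.range n)
    (fun k hkn => if_neg (by rw [hk]; simpa using hkn))]
  exact Finset.sum_congr rfl fun k hkn => if_pos ((hk k).2 (by simpa using hkn))

variable [NormedSpace ℝ E] {s : ℕ → ℝ} {u h : ℝ → E} {g : ℕ → E} {x₀ : E}

lemma eq_add_integral_between_jumps (hs : StrictMono s) (hs0 : s 0 = 0)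
    (hint : ∀ t, 0 ≤ t → IntervalIntegrable h volume 0 t)
    (hu : ∀ t, 0 ≤ t → u t = x₀ + (∫ r in (0 : ℝ)..t, h r)
      - ∑' k, if s (k + 1) ≤ t then g k else 0)
    {n : ℕ} {t : ℝ} (h1 : s n ≤ t) (h2 : t < s (n + 1)) :
    u t = u (s n) + ∫ r in (s n)..t, h r := by
  have hn : 0 ≤ s n := hs0 ▸ hs.monotone n.zero_le
  rw [hu t (hn.trans h1), hu _ hn, sum_jumps_eq hs g h1 h2,
    sum_jumps_eq hs g le_rfl (hs n.lt_succ_self),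
    ← intervalIntegral.integral_interval_sub_left (hint _ (hn.trans h1)) (hint _ hn)]
  abel

lemma eq_add_integral_sub_jump (hs : StrictMono s) (hs0 : s 0 = 0)
    (hint : ∀ t, 0 ≤ t → IntervalIntegrable h volume 0 t)
    (hu : ∀ t, 0 ≤ t → u t = x₀ + (∫ r in (0 : ℝ)..t, h r)
      - ∑' k, if s (k + 1) ≤ t then g k else 0) (n : ℕ) :
    u (s (n + 1)) = u (s n) + (∫ r in (s n)..(s (n + 1)), h r) - g n := by
  have hn : ∀ n, 0 ≤ s n := fun n => hs0 ▸ hs.monotone n.zero_le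
  rw [hu _ (hn _), hu _ (hn n), sum_jumps_eq hs g le_rfl (hs (n + 1).lt_succ_self),
    sum_jumps_eq hs g le_rfl (hs n.lt_succ_self), Finset.sum_range_succ,
    ← intervalIntegral.integral_interval_sub_left (hint _ (hn (n + 1))) (hint _ (hn n))]
  abel

lemma tendsto_left_at_jump (hs : StrictMono s) (hs0 : s 0 = 0)
    (hint : ∀ t, 0 ≤ t → IntervalIntegrable h volume 0 t)
    (hu : ∀ t, 0 ≤ t → u t = x₀ + (∫ r in (0 : ℝ)..t, h r)
      - ∑' k, if s (k + 1) ≤ t then g k else 0) (n : ℕ) :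
    Tendsto u (𝓝[<] s (n + 1)) (𝓝 (u (s n) + ∫ r in (s n)..(s (n + 1)), h r)) := by
  have hn : ∀ n, 0 ≤ s n := fun n => hs0 ▸ hs.monotone n.zero_le
  have hlt := hs n.lt_succ_self
  have hi : IntegrableOn h (Set.uIcc (s n) (s (n + 1))) := by
    rw [Set.uIcc_of_le hlt.le, integrableOn_Icc_iff_integrableOn_Ioc,
      ← intervalIntegrable_iff_integrableOn_Ioc_of_le hlt.le]
    exact (hint _ (hn n)).symm.trans (hint _ (hn (n + 1)))
  have hc := intervalIntegral.continuousOn_primitive_interval hi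
  rw [Set.uIcc_of_le hlt.le] at hc
  have h1 := (hc (s (n + 1)) ⟨hlt.le, le_rfl⟩).mono Set.Ico_subset_Icc_self
  rw [ContinuousWithinAt, nhdsWithin_Ico_eq_nhdsLT hlt] at h1
  refine (h1.const_add (u (s n))).congr' ?_
  filter_upwards [Ico_mem_nhdsLT hlt] with t ht
  exact (eq_add_integral_between_jumps hs hs0 hint hu ht.1 ht.2).symm

end Increments

/-- `φ` is the flow of `du = η (v - u) dt`, `dv = η' (u - v) dt`, on the times `t ≥ 0`: every
solution of the integrated equations on `[a, b)` follows it, and it is continuous in the final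
time. Nothing is asked about the existence of solutions. -/
structure IsMixingFlow {E : Type*} [NormedAddCommGroup E] [NormedSpace ℝ E] (η η' : ℝ → ℝ)
    (φ : ℝ → ℝ → E × E → E × E) : Prop where
  continuousAt : ∀ a b y, 0 ≤ a → a < b → ContinuousAt (fun r => φ a r y) b
  eq_flow : ∀ (a b : ℝ) (u v : ℝ → E), 0 ≤ a → a < b →
    (∀ t ∈ Set.Ico a b, IntervalIntegrable (fun s => η s • (v s - u s)) volume a t) →
    (∀ t ∈ Set.Ico a b, IntervalIntegrable (fun s => η' s • (u s - v s)) volume a t) →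
    (∀ t ∈ Set.Ico a b, u t = u a + ∫ s in a..t, η s • (v s - u s)) →
    (∀ t ∈ Set.Ico a b, v t = v a + ∫ s in a..t, η' s • (u s - v s)) →
    ∀ t ∈ Set.Ico a b, (u t, v t) = φ a t (u a, v a)

/-- The effect on the pair `(x, z)` of a jump at time `r`; `y` is the pair just before it. -/
noncomputable def gradientJump {d : ℕ} (f : EuclideanSpace ℝ (Fin d) → ℝ) (γ γ' : ℝ → ℝ) (r : ℝ)
    (y : EuclideanSpace ℝ (Fin d) × EuclideanSpace ℝ (Fin d)) :
    EuclideanSpace ℝ (Fin d) × EuclideanSpace ℝ (Fin d) :=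
  (y.1 - γ r • ∇ f y.1, y.2 - γ' r • ∇ f y.1)

section ContinuizedPath

variable {d : ℕ} {f : EuclideanSpace ℝ (Fin d) → ℝ} {η η' γ γ' : ℝ → ℝ}
  {x₀ z₀ : EuclideanSpace ℝ (Fin d)} {u v : ℝ → EuclideanSpace ℝ (Fin d)}
  {φ : ℝ → ℝ → EuclideanSpace ℝ (Fin d) × EuclideanSpace ℝ (Fin d) →
    EuclideanSpace ℝ (Fin d) × EuclideanSpace ℝ (Fin d)} {w : ℕ → ℝ}

/-- A continuized path is the deterministic functional `jumpState` of the waiting times, followed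
by the flow. -/
theorem IsContinuizedPath.eq_flow_jumpState (hφ : IsMixingFlow η η' φ) (hw : ∀ i, 0 < w i)
    (hp : IsContinuizedPath f η η' γ γ' (fun k => ∑ i ∈ Finset.range (k + 1), w i) x₀ z₀ u v)
    (n : ℕ) {t : ℝ} (h1 : (jumpState φ (gradientJump f γ γ') (x₀, z₀) w n).1 ≤ t)
    (h2 : t < (jumpState φ (gradientJump f γ γ') (x₀, z₀) w (n + 1)).1) :
    (u t, v t) = φ (jumpState φ (gradientJump f γ γ') (x₀, z₀) w n).1 t
      (jumpState φ (gradientJump f γ γ') (x₀, z₀) w n).2 := by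
  set S := jumpState φ (gradientJump f γ γ') (x₀, z₀) w with hS
  set s : ℕ → ℝ := fun n => ∑ i ∈ Finset.range n, w i with hs_def
  have hS1 : ∀ n, (S n).1 = s n := fun n => jumpState_fst _ _
  have hs0 : s 0 = 0 := by simp [hs_def]
  have hs : StrictMono s := strictMono_nat_of_lt_succ fun n => by
    simp only [hs_def, Finset.sum_range_succ]
    linarith [hw n]
  have hn : ∀ n, 0 ≤ s n := fun n => hs0 ▸ hs.monotone n.zero_le
  have hflow : ∀ n, ∀ t ∈ Set.Ico (s n) (s (n + 1)),
      (u t, v t) = φ (s n) t (u (s n), v (s n)) := by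
    intro n
    refine hφ.eq_flow _ _ u v (hn n) (hs n.lt_succ_self) (fun t ht => ?_) (fun t ht => ?_)
      (fun t ht => ?_) (fun t ht => ?_)
    · exact (hp.integrable_fst _ (hn n)).symm.trans (hp.integrable_fst _ ((hn n).trans ht.1))
    · exact (hp.integrable_snd _ (hn n)).symm.trans (hp.integrable_snd _ ((hn n).trans ht.1))
    · exact eq_add_integral_between_jumps hs hs0 hp.integrable_fst hp.eq_fst ht.1 ht.2
    · exact eq_add_integral_between_jumps hs hs0 hp.integrable_snd hp.eq_snd ht.1 ht.2
  have hstate : ∀ n, (S n).2 = (u (s n), v (s n)) := by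
    intro n
    induction n with
    | zero =>
      have hsum : ∀ g : ℕ → EuclideanSpace ℝ (Fin d),
          (∑' k, if ∑ i ∈ Finset.range (k + 1), w i ≤ 0 then g k else 0) = 0 := fun g => by
        have := sum_jumps_eq hs g hs0.le (hs0 ▸ hs Nat.zero_lt_one)
        simpa [hs_def] using this
      have e1 := hp.eq_fst 0 le_rfl
      have e2 := hp.eq_snd 0 le_rfl
      rw [hsum, intervalIntegral.integral_same] at e1 e2
      rw [hs0, e1, e2]
      simp [hS, jumpState]
    | succ n ih =>
      have hlt := hs n.lt_succ_self
      have hfl : Tendsto (fun t => (u t, v t)) (𝓝[<] s (n + 1))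
          (𝓝 (φ (s n) (s (n + 1)) (u (s n), v (s n)))) := by
        refine ((hφ.continuousAt _ _ _ (hn n) hlt).tendsto.mono_left nhdsWithin_le_nhds).congr' ?_
        filter_upwards [Ico_mem_nhdsLT hlt] with t ht
        exact (hflow n t ht).symm
      have hlim : Function.leftLim u (s (n + 1))
          = (φ (s n) (s (n + 1)) (u (s n), v (s n))).1 :=
        leftLim_eq_of_tendsto hfl.fst_nhds
      have a1 := tendsto_nhds_unique
        (tendsto_left_at_jump hs hs0 hp.integrable_fst hp.eq_fst n) hfl.fst_nhds
      have a2 := tendsto_nhds_unique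
        (tendsto_left_at_jump hs hs0 hp.integrable_snd hp.eq_snd n) hfl.snd_nhds
      have b1 := eq_add_integral_sub_jump hs hs0 hp.integrable_fst hp.eq_fst n
      have b2 := eq_add_integral_sub_jump hs hs0 hp.integrable_snd hp.eq_snd n
      have hsn : (S n).1 + w n = s (n + 1) := by
        rw [hS1]
        simp [hs_def, Finset.sum_range_succ]
      have hSn : (S (n + 1)).2 = gradientJump f γ γ' ((S n).1 + w n)
        (φ (S n).1 ((S n).1 + w n) (S n).2) := rfl
      rw [hSn, hsn, ih, hS1, b1, b2, a1, a2]
      simp only [gradientJump, ← hlim]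
      rfl
  rw [hS1] at h1 h2
  rw [hS1, hstate]
  exact hflow n t ⟨h1, h2⟩

end ContinuizedPath

/-! ### The explicit flows of the two parameter choices -/

section Flows

variable {E : Type*} [NormedAddCommGroup E] [NormedSpace ℝ E]

lemma eq_left_of_hasDerivAt_zero {p : ℝ → E} {a b : ℝ} (hc : ContinuousOn p (Set.Ico a b))
    (hd : ∀ t ∈ Set.Ioo a b, HasDerivAt p 0 t) {t : ℝ} (ht : t ∈ Set.Ico a b) : p t = p a := by
  have hab : a < b := ht.1.trans_lt ht.2
  rcases ht.1.eq_or_lt with rfl | hat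
  · rfl
  have h1 : Tendsto p (𝓝[>] a) (𝓝 (p a)) := by
    have := (hc a ⟨le_rfl, hab⟩).mono Set.Ioo_subset_Ico_self
    rwa [ContinuousWithinAt, nhdsWithin_Ioo_eq_nhdsGT hab] at this
  have h2 : Tendsto p (𝓝[>] a) (𝓝 (p t)) := by
    refine tendsto_const_nhds.congr' ?_
    filter_upwards [Ioo_mem_nhdsGT hab] with r hr
    exact isOpen_Ioo.is_const_of_deriv_eq_zero isPreconnected_Ioo
      (fun q hq => (hd q hq).differentiableAt.differentiableWithinAt)
      (fun q hq => (hd q hq).deriv) ⟨hat, ht.2⟩ hr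
  exact tendsto_nhds_unique h2 h1

lemma continuousOn_Ico_of_eq_add_integral {u h : ℝ → E} {a b : ℝ}
    (hint : ∀ t ∈ Set.Ico a b, IntervalIntegrable h volume a t)
    (hu : ∀ t ∈ Set.Ico a b, u t = u a + ∫ s in a..t, h s) : ContinuousOn u (Set.Ico a b) := by
  intro t ht
  obtain ⟨c, htc, hcb⟩ := exists_between ht.2
  have hac : a ≤ c := ht.1.trans htc.le
  have hi : IntegrableOn h (Set.uIcc a c) := by
    rw [Set.uIcc_of_le hac, integrableOn_Icc_iff_integrableOn_Ioc,
      ← intervalIntegrable_iff_integrableOn_Ioc_of_le hac]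
    exact hint c ⟨hac, hcb⟩
  have hc := intervalIntegral.continuousOn_primitive_interval hi
  rw [Set.uIcc_of_le hac] at hc
  have h1 : ContinuousOn u (Set.Icc a c) :=
    (continuousOn_const.add hc).congr fun r hr => hu r ⟨hr.1, hr.2.trans_lt hcb⟩
  refine (h1 t ⟨ht.1, htc.le⟩).mono_of_mem_nhdsWithin ?_
  have : Set.Iio c ∈ 𝓝[Set.Ico a b] t := mem_nhdsWithin_of_mem_nhds (Iio_mem_nhds htc)
  filter_upwards [this, self_mem_nhdsWithin] with r hr hr2
  exact ⟨hr2.1, hr.le⟩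

lemma hasDerivAt_of_eq_add_integral [CompleteSpace E] {u h : ℝ → E} {a b : ℝ}
    (hint : ∀ t ∈ Set.Ico a b, IntervalIntegrable h volume a t)
    (hu : ∀ t ∈ Set.Ico a b, u t = u a + ∫ s in a..t, h s) (hh : ContinuousOn h (Set.Ioo a b))
    {t : ℝ} (ht : t ∈ Set.Ioo a b) : HasDerivAt u (h t) t := by
  have h1 := intervalIntegral.integral_hasDerivAt_right (hint t ⟨ht.1.le, ht.2⟩)
    (hh.stronglyMeasurableAtFilter isOpen_Ioo t ht) (hh.continuousAt (isOpen_Ioo.mem_nhds ht))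
  refine (h1.const_add (u a)).congr_of_eventuallyEq ?_
  filter_upwards [isOpen_Ioo.mem_nhds ht] with r hr
  exact hu r ⟨hr.1.le, hr.2⟩

/-- The flow of `dx = (2 / t) (z - x) dt`, `dz = 0`: the quantity `t² (x - z)` is conserved. From
the time `0` the flow sends every `(x, z)` to `(z, z)`, by the convention `0 / 0 = 0`, as it
must because a solution can leave the singular time only from the diagonal. -/
noncomputable def decayingFlow (s r : ℝ) (y : E × E) : E × E :=
  (y.2 + (s / r) ^ 2 • (y.1 - y.2), y.2)

lemma decayingFlow_zero (r : ℝ) (y : E × E) : decayingFlow 0 r y = (y.2, y.2) := by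
  simp [decayingFlow]

lemma isMixingFlow_decayingFlow [CompleteSpace E] :
    IsMixingFlow (fun t => 2 / t) (fun _ => 0) (decayingFlow (E := E)) where
  continuousAt := by
    intro a b y ha hab
    have hb : b ≠ 0 := (ha.trans_lt hab).ne'
    unfold decayingFlow
    exact ContinuousAt.prodMk (by fun_prop (disch := exact hb)) continuousAt_const
  eq_flow := by
    intro a b u v ha hab hi1 hi2 hu hv
    have hva : ∀ t ∈ Set.Ico a b, v t = v a := fun t ht => by simpa using hv t ht
    have hcu := continuousOn_Ico_of_eq_add_integral hi1 hu
    have hcv : ContinuousOn v (Set.Ico a b) := continuousOn_const.congr hva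
    have hpos : ∀ t ∈ Set.Ioo a b, t ≠ 0 := fun t ht => (ha.trans_lt ht.1).ne'
    have hdu : ∀ t ∈ Set.Ioo a b, HasDerivAt u ((2 / t) • (v t - u t)) t := fun t ht =>
      hasDerivAt_of_eq_add_integral hi1 hu
        (ContinuousOn.smul (continuousOn_const.div continuousOn_id hpos)
          ((hcv.sub hcu).mono Set.Ioo_subset_Ico_self)) ht
    have hcons : ∀ t ∈ Set.Ico a b, t ^ 2 • (u t - v a) = a ^ 2 • (u a - v a) := fun t ht => by
      refine eq_left_of_hasDerivAt_zero (p := fun t => t ^ 2 • (u t - v a)) (by fun_prop)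
        (fun r hr => ?_) ht
      have e := ((hasDerivAt_id r).pow 2).smul ((hdu r hr).sub_const (v a))
      convert! e using 1
      have hr0 := hpos r hr
      rw [hva r ⟨hr.1.le, hr.2⟩, smul_smul]
      simp only [id, Pi.pow_apply]
      rw [show r ^ 2 * (2 / r) = 2 * r by field_simp, ← neg_sub (u r) (v a), smul_neg]
      simp
    have hposflow : ∀ t ∈ Set.Ico a b, t ≠ 0 → u t = v a + (a / t) ^ 2 • (u a - v a) := by
      intro t ht ht0
      rw [div_pow, div_eq_inv_mul, mul_smul, ← hcons t ht, smul_smul,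
        inv_mul_cancel₀ (pow_ne_zero 2 ht0), one_smul]
      abel
    intro t ht
    rw [decayingFlow, hva t ht]
    by_cases ht0 : t = 0
    · obtain rfl : a = 0 := le_antisymm (ht.1.trans ht0.le) ha
      subst ht0
      -- right continuity at the singular time forces the path to start on the diagonal
      have h1 : Tendsto u (𝓝[>] 0) (𝓝 (u 0)) := by
        have := (hcu 0 ⟨le_rfl, hab⟩).mono Set.Ioo_subset_Ico_self
        rwa [ContinuousWithinAt, nhdsWithin_Ioo_eq_nhdsGT hab] at this
      have h2 : Tendsto u (𝓝[>] 0) (𝓝 (v 0)) := by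
        refine tendsto_const_nhds.congr' ?_
        filter_upwards [Ioo_mem_nhdsGT hab] with r hr
        simpa using (hposflow r ⟨hr.1.le, hr.2⟩ hr.1.ne').symm
      rw [tendsto_nhds_unique h1 h2]
      simp
    · rw [hposflow t ht ht0]

/-- The flow of `dx = σ (z - x) dt`, `dz = σ (x - z) dt`: the quantities `x + z` and
`exp (2 σ t) (x - z)` are conserved. -/
noncomputable def constantRateFlow (σ s r : ℝ) (y : E × E) : E × E :=
  ((2⁻¹ : ℝ) • (y.1 + y.2) + (2⁻¹ * Real.exp (2 * σ * (s - r))) • (y.1 - y.2),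
    (2⁻¹ : ℝ) • (y.1 + y.2) - (2⁻¹ * Real.exp (2 * σ * (s - r))) • (y.1 - y.2))

lemma constantRateFlow_self (σ s : ℝ) (y : E × E) : constantRateFlow σ s s y = y := by
  ext1
  · simp only [constantRateFlow, sub_self, mul_zero, Real.exp_zero, mul_one]
    module
  · simp only [constantRateFlow, sub_self, mul_zero, Real.exp_zero, mul_one]
    module

lemma isMixingFlow_constantRateFlow [CompleteSpace E] (σ : ℝ) :
    IsMixingFlow (fun _ => σ) (fun _ => σ) (constantRateFlow (E := E) σ) where
  continuousAt := by
    intro a b y ha hab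
    unfold constantRateFlow
    fun_prop
  eq_flow := by
    intro a b u v ha hab hi1 hi2 hu hv t ht
    have hcu := continuousOn_Ico_of_eq_add_integral hi1 hu
    have hcv := continuousOn_Ico_of_eq_add_integral hi2 hv
    have hdu : ∀ t ∈ Set.Ioo a b, HasDerivAt u (σ • (v t - u t)) t := fun t ht =>
      hasDerivAt_of_eq_add_integral hi1 hu
        (((hcv.sub hcu).const_smul σ).mono Set.Ioo_subset_Ico_self) ht
    have hdv : ∀ t ∈ Set.Ioo a b, HasDerivAt v (σ • (u t - v t)) t := fun t ht =>
      hasDerivAt_of_eq_add_integral hi2 hv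
        (((hcu.sub hcv).const_smul σ).mono Set.Ioo_subset_Ico_self) ht
    have hsum : u t + v t = u a + v a := by
      refine eq_left_of_hasDerivAt_zero (p := fun t => u t + v t) (by fun_prop)
        (fun r hr => ?_) ht
      convert! (hdu r hr).add (hdv r hr) using 1
      module
    have hdiff : Real.exp (2 * σ * t) • (u t - v t) = Real.exp (2 * σ * a) • (u a - v a) := by
      refine eq_left_of_hasDerivAt_zero (p := fun t => Real.exp (2 * σ * t) • (u t - v t))
        (by fun_prop) (fun r hr => ?_) ht
      have e : HasDerivAt (fun r : ℝ => Real.exp (2 * σ * r))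
          (Real.exp (2 * σ * r) * (2 * σ)) r := by
        simpa using ((hasDerivAt_id r).const_mul (2 * σ)).exp
      convert! e.smul ((hdu r hr).sub (hdv r hr)) using 1
      simp only [Pi.sub_apply]
      module
    have hdiff2 : u t - v t = Real.exp (2 * σ * (a - t)) • (u a - v a) := by
      rw [mul_sub, Real.exp_sub, div_eq_inv_mul, mul_smul, ← hdiff, smul_smul,
        inv_mul_cancel₀ (Real.exp_ne_zero _), one_smul]
    rw [constantRateFlow, ← hsum, mul_smul, ← hdiff2]
    ext1 <;> module

lemma hasDerivAt_decayingFlow_fst (s : ℝ) (y : E × E) {r : ℝ} (hr : r ≠ 0) :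
    HasDerivAt (fun r => (decayingFlow s r y).1)
      ((2 / r) • ((decayingFlow s r y).2 - (decayingFlow s r y).1)) r := by
  have e : HasDerivAt (fun r : ℝ => (s / r) ^ 2) (-(2 / r) * (s / r) ^ 2) r := by
    have := ((hasDerivAt_inv hr).const_mul s).pow 2
    simp only [← div_eq_mul_inv] at this
    convert! this using 1
    simp only [Nat.cast_ofNat, Nat.add_one_sub_one, pow_one]
    field_simp
  convert! (e.smul_const (y.1 - y.2)).const_add y.2 using 1
  simp only [decayingFlow]
  module

lemma hasDerivAt_constantRateFlow (σ s : ℝ) (y : E × E) (r : ℝ) :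
    HasDerivAt (fun r => (constantRateFlow σ s r y).1)
      (σ • ((constantRateFlow σ s r y).2 - (constantRateFlow σ s r y).1)) r ∧
    HasDerivAt (fun r => (constantRateFlow σ s r y).2)
      (σ • ((constantRateFlow σ s r y).1 - (constantRateFlow σ s r y).2)) r := by
  have e : HasDerivAt (fun r : ℝ => 2⁻¹ * Real.exp (2 * σ * (s - r)))
      (-(σ * Real.exp (2 * σ * (s - r)))) r := by
    have := ((((hasDerivAt_id r).const_sub s).const_mul (2 * σ)).exp).const_mul (2⁻¹ : ℝ)
    convert! this using 1
    simp only [id]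
    ring
  constructor
  · convert! (e.smul_const (y.1 - y.2)).const_add ((2⁻¹ : ℝ) • (y.1 + y.2)) using 1
    simp only [constantRateFlow]
    module
  · convert! (e.smul_const (y.1 - y.2)).const_sub ((2⁻¹ : ℝ) • (y.1 + y.2)) using 1
    simp only [constantRateFlow]
    module

end Flows

/-! ### The Lyapunov function -/

section Lyapunov

variable {d : ℕ} {f : EuclideanSpace ℝ (Fin d) → ℝ}

lemma measurable_gradient_euclidean : Measurable (∇ f) :=
  (InnerProductSpace.toDual ℝ (EuclideanSpace ℝ (Fin d))).symm.continuous.measurable.comp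
    (measurable_fderiv ℝ f)

lemma measurable_gradientJump {γ γ' : ℝ → ℝ} (hγ : Measurable γ) (hγ' : Measurable γ') :
    Measurable fun q : ℝ × EuclideanSpace ℝ (Fin d) × EuclideanSpace ℝ (Fin d) =>
      gradientJump f γ γ' q.1 q.2 := by
  have := measurable_gradient_euclidean (f := f)
  unfold gradientJump
  fun_prop

lemma hasDerivAt_comp_of_differentiable (hdiff : Differentiable ℝ f)
    {p : ℝ → EuclideanSpace ℝ (Fin d)} {p' : EuclideanSpace ℝ (Fin d)} {r : ℝ}
    (hp : HasDerivAt p p' r) : HasDerivAt (fun r => f (p r)) (inner ℝ (∇ f (p r)) p') r := by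
  have := (hdiff (p r)).hasGradientAt.hasFDerivAt.comp_hasDerivAt r hp
  simpa [Function.comp_def] using this

lemma ConvexOn.add_inner_gradient_le (hconv : ConvexOn ℝ Set.univ f) (hdiff : Differentiable ℝ f)
    (x y : EuclideanSpace ℝ (Fin d)) : f x + inner ℝ (∇ f x) (y - x) ≤ f y := by
  have hline : HasDerivAt (fun r : ℝ => AffineMap.lineMap x y r) (y - x) 0 :=
    AffineMap.hasDerivAt_lineMap
  have hd := hasDerivAt_comp_of_differentiable hdiff hline
  have hc : ConvexOn ℝ Set.univ (f ∘ AffineMap.lineMap (k := ℝ) x y) := by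
    simpa using hconv.comp_affineMap (AffineMap.lineMap (k := ℝ) x y)
  have := hc.le_slope_of_hasDerivAt (Set.mem_univ 0) (Set.mem_univ 1) one_pos hd
  simp only [slope_def_field, Function.comp_apply, AffineMap.lineMap_apply_zero,
    AffineMap.lineMap_apply_one, sub_zero, div_one] at this
  linarith

/-- The Lyapunov function `A (f x - f xstar) + B / 2 ‖z - xstar‖²` at the time `r`. -/
noncomputable def lyapunov (f : EuclideanSpace ℝ (Fin d) → ℝ) (xstar : EuclideanSpace ℝ (Fin d))
    (A B : ℝ → ℝ) (r : ℝ) (y : EuclideanSpace ℝ (Fin d) × EuclideanSpace ℝ (Fin d)) : ℝ :=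
  A r * (f y.1 - f xstar) + B r / 2 * ‖y.2 - xstar‖ ^ 2

variable {xstar : EuclideanSpace ℝ (Fin d)} {A B : ℝ → ℝ}

lemma lyapunov_nonneg (hmin : ∀ y, f xstar ≤ f y) {r : ℝ} (hA : 0 ≤ A r) (hB : 0 ≤ B r)
    (y : EuclideanSpace ℝ (Fin d) × EuclideanSpace ℝ (Fin d)) : 0 ≤ lyapunov f xstar A B r y :=
  add_nonneg (mul_nonneg hA (sub_nonneg.2 (hmin _))) (by positivity)

lemma measurable_lyapunov (hf : Continuous f) (hA : Measurable A) (hB : Measurable B) :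
    Measurable fun q : ℝ × EuclideanSpace ℝ (Fin d) × EuclideanSpace ℝ (Fin d) =>
      lyapunov f xstar A B q.1 q.2 := by
  have := hf.measurable
  unfold lyapunov
  fun_prop

lemma hasDerivAt_lyapunov (hdiff : Differentiable ℝ f)
    {y : ℝ → EuclideanSpace ℝ (Fin d) × EuclideanSpace ℝ (Fin d)}
    {p' q' : EuclideanSpace ℝ (Fin d)} {A' B' r : ℝ} (hp : HasDerivAt (fun r => (y r).1) p' r)
    (hq : HasDerivAt (fun r => (y r).2) q' r) (hA : HasDerivAt A A' r) (hB : HasDerivAt B B' r) :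
    HasDerivAt (fun r => lyapunov f xstar A B r (y r))
      (A' * (f (y r).1 - f xstar) + A r * inner ℝ (∇ f (y r).1) p'
        + B' / 2 * ‖(y r).2 - xstar‖ ^ 2 + B r * inner ℝ ((y r).2 - xstar) q') r := by
  have h1 := hA.mul ((hasDerivAt_comp_of_differentiable hdiff hp).sub_const (f xstar))
  have h2 := (hB.div_const 2).mul (hq.sub_const xstar).norm_sq
  convert! h1.add h2 using 1
  ring

lemma IsLSmooth.sub_gradient_le {L : ℝ} (hL : 0 < L) (hsmooth : IsLSmooth L f)
    (x : EuclideanSpace ℝ (Fin d)) : f (x - (1 / L) • ∇ f x) ≤ f x - 1 / (2 * L) * ‖∇ f x‖ ^ 2 := by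
  have h := hsmooth x (x - (1 / L) • ∇ f x)
  rw [sub_sub_cancel_left, inner_neg_right, inner_smul_right, real_inner_self_eq_norm_sq,
    norm_neg, norm_smul, Real.norm_of_nonneg (by positivity), mul_pow] at h
  refine h.trans (le_of_eq ?_)
  field_simp
  ring

/-- The balance `A / L = B γ'²` makes the squared gradient norms in the effect of a jump cancel,
and `A η = B γ'` reduces the scalar products with the gradient to the one with `xstar - x`. -/
lemma lyapunov_gradientJump_le {L : ℝ} (hL : 0 < L) (hsmooth : IsLSmooth L f) {γ' : ℝ → ℝ}
    {r η η' A' B' : ℝ} (hA : 0 ≤ A r) (h1 : A r / L = B r * γ' r ^ 2) (h2 : A r * η = B r * γ' r)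
    (x z : EuclideanSpace ℝ (Fin d))
    (h : A' * (f x - f xstar) + A r * η * inner ℝ (∇ f x) (xstar - x)
      + B' / 2 * ‖z - xstar‖ ^ 2 + B r * η' * inner ℝ (z - xstar) (x - z) ≤ 0) :
    lyapunov f xstar A B r (gradientJump f (fun _ => 1 / L) γ' r (x, z)) ≤
      lyapunov f xstar A B r (x, z) - (A' * (f x - f xstar) + A r * inner ℝ (∇ f x) (η • (z - x))
        + B' / 2 * ‖z - xstar‖ ^ 2 + B r * inner ℝ (z - xstar) (η' • (x - z))) := by
  have hs := mul_le_mul_of_nonneg_left (hsmooth.sub_gradient_le hL x) hA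
  have hn : ‖z - γ' r • ∇ f x - xstar‖ ^ 2 = ‖z - xstar‖ ^ 2
      - 2 * γ' r * inner ℝ (∇ f x) (z - xstar) + γ' r ^ 2 * ‖∇ f x‖ ^ 2 := by
    rw [show z - γ' r • ∇ f x - xstar = (z - xstar) - γ' r • ∇ f x by abel, norm_sub_sq_real,
      inner_smul_right, real_inner_comm, norm_smul, mul_pow, Real.norm_eq_abs, sq_abs]
    ring
  have hin : inner ℝ (∇ f x) (z - x)
      = inner ℝ (∇ f x) (z - xstar) + inner ℝ (∇ f x) (xstar - x) := by
    rw [← inner_add_right]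
    congr 1
    abel
  have hAL : A r * (1 / (2 * L) * ‖∇ f x‖ ^ 2) = B r * γ' r ^ 2 / 2 * ‖∇ f x‖ ^ 2 := by
    rw [← h1]
    field_simp
  simp only [lyapunov, gradientJump, hn, inner_smul_right, hin]
  have e1 : A r * (η * (inner ℝ (∇ f x) (z - xstar) + inner ℝ (∇ f x) (xstar - x)))
      = B r * γ' r * inner ℝ (∇ f x) (z - xstar) + A r * η * inner ℝ (∇ f x) (xstar - x) := by
    rw [← h2]
    ring
  rw [e1]
  linarith

end Lyapunov

/-! ### The convergence rates -/

section Main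

variable {d : ℕ} {f : EuclideanSpace ℝ (Fin d) → ℝ}
  {Ω : Type*} {T : ℕ → Ω → ℝ}

lemma sum_waitingTime (T : ℕ → Ω → ℝ) (n : ℕ) (ω : Ω) :
    ∑ i ∈ Finset.range (n + 1), waitingTime T i ω = T n ω := by
  induction n with
  | zero => simp [waitingTime]
  | succ n ih => rw [Finset.sum_range_succ, ih]; simp [waitingTime]

variable [MeasurableSpace Ω] {P : Measure Ω}

lemma IsPoissonJumpTimes.measurable_waitingTime (hT : IsPoissonJumpTimes P T) (k : ℕ) :
    Measurable (waitingTime T k) := by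
  cases k with
  | zero => exact hT.measurable 0
  | succ k => exact (hT.measurable (k + 1)).sub (hT.measurable k)

lemma IsPoissonJumpTimes.ae_waitingTime_pos (hT : IsPoissonJumpTimes P T) :
    ∀ᵐ ω ∂P, ∀ k, 0 < waitingTime T k ω := by
  refine ae_all_iff.2 fun k => ?_
  have h := ae_pos_expMeasure
  rw [← (hT.law k).map_eq] at h
  exact ae_of_ae_map (hT.law k).aemeasurable h

/-- The bound on the expected value that a Lyapunov function of the flow and of the gradient jumps
implies for every continuized process. -/
theorem IsContinuizedProcess.integral_le_of_lyapunov [IsProbabilityMeasure P]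
    (hdiff : Differentiable ℝ f) {xstar : EuclideanSpace ℝ (Fin d)} (hmin : ∀ y, f xstar ≤ f y)
    (hT : IsPoissonJumpTimes P T) {η η' γ γ' : ℝ → ℝ} (hγ : Measurable γ) (hγ' : Measurable γ')
    {x₀ z₀ : EuclideanSpace ℝ (Fin d)} {x z : ℝ → Ω → EuclideanSpace ℝ (Fin d)}
    (hp : IsContinuizedProcess P f η η' γ γ' T x₀ z₀ x z)
    {φ : ℝ → ℝ → EuclideanSpace ℝ (Fin d) × EuclideanSpace ℝ (Fin d) →
      EuclideanSpace ℝ (Fin d) × EuclideanSpace ℝ (Fin d)} (hφ : IsMixingFlow η η' φ)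
    (hφm : Measurable fun q : ℝ × ℝ × EuclideanSpace ℝ (Fin d) × EuclideanSpace ℝ (Fin d) =>
      φ q.1 q.2.1 q.2.2)
    {A B : ℝ → ℝ} (hA : Measurable A) (hB : Measurable B) (hA0 : ∀ r, 0 ≤ r → 0 ≤ A r)
    (hB0 : ∀ r, 0 ≤ r → 0 ≤ B r)
    (hVs : ∀ s y, 0 ≤ s → lyapunov f xstar A B s (φ s s y) ≤ lyapunov f xstar A B s y)
    (hc : ∀ s y, 0 ≤ s →
      ContinuousOn (fun r => lyapunov f xstar A B r (φ s r y)) (Set.Ici s))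
    (hd : ∀ s y, 0 ≤ s → ∃ g' : ℝ → ℝ, ∀ r, s < r →
      HasDerivAt (fun r => lyapunov f xstar A B r (φ s r y)) (g' r) r ∧
        lyapunov f xstar A B r (gradientJump f γ γ' r (φ s r y))
          ≤ lyapunov f xstar A B r (φ s r y) - g' r)
    {t : ℝ} (ht : 0 ≤ t) (hAt : 0 < A t) :
    Integrable (fun ω => f (x t ω)) P ∧
      (∫ ω, f (x t ω) ∂P) - f xstar ≤ lyapunov f xstar A B 0 (x₀, z₀) / A t := by
  have hW := hT.ae_waitingTime_pos
  have key := integrable_and_integral_le_of_lyapunov (P := P) (y₀ := (x₀, z₀)) hφm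
    (measurable_gradientJump hγ hγ') hT.indep hT.measurable_waitingTime hT.law hW
    (measurable_lyapunov hdiff.continuous hA hB)
    (fun r y hr => lyapunov_nonneg hmin (hA0 r hr) (hB0 r hr) y) hVs hc hd ht
    (F := fun y => f y.1 - f xstar)
    ((hdiff.continuous.measurable.comp measurable_fst).sub measurable_const)
    (fun y => sub_nonneg.2 (hmin _)) hAt
    (fun y => le_add_of_nonneg_right (mul_nonneg (div_nonneg (hB0 t ht) two_pos.le) (sq_nonneg _)))
    (X := fun ω => (x t ω, z t ω)) (by
      filter_upwards [hW, hp] with ω hWω hpω n h1 h2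
      simp_rw [← sum_waitingTime T] at hpω
      exact hpω.eq_flow_jumpState hφ hWω n h1 h2)
  have hint : Integrable (fun ω => f (x t ω)) P :=
    (key.1.add (integrable_const (f xstar))).congr (ae_of_all _ fun ω => by simp)
  refine ⟨hint, ?_⟩
  have h2 := key.2
  rwa [integral_sub hint (integrable_const _), integral_const, probReal_univ, one_smul] at h2

end Main

theorem theorem3 {d : ℕ} (f : EuclideanSpace ℝ (Fin d) → ℝ)
    (hconv : ConvexOn ℝ Set.univ f) (hdiff : Differentiable ℝ f)
    (L : ℝ) (hL : 0 < L) (hsmooth : IsLSmooth L f)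
    (xstar : EuclideanSpace ℝ (Fin d)) (hmin : ∀ y, f xstar ≤ f y)
    {Ω : Type*} [MeasurableSpace Ω] (P : Measure Ω) [IsProbabilityMeasure P]
    (T : ℕ → Ω → ℝ) (hT : IsPoissonJumpTimes P T)
    (x₀ z₀ : EuclideanSpace ℝ (Fin d)) (x z : ℝ → Ω → EuclideanSpace ℝ (Fin d)) :
    (IsContinuizedProcess P f (fun t => 2 / t) (fun _ => 0) (fun _ => 1 / L)
        (fun t => t / (2 * L)) T x₀ z₀ x z →
      ∀ t : ℝ, 0 < t →
        Integrable (fun ω => f (x t ω)) P ∧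
        (∫ ω, f (x t ω) ∂P) - f xstar ≤ 2 * L * ‖z₀ - xstar‖ ^ 2 / t ^ 2) ∧
    (∀ μ : ℝ, 0 < μ → IsMuStronglyConvex μ f →
      IsContinuizedProcess P f (fun _ => Real.sqrt (μ / L)) (fun _ => Real.sqrt (μ / L))
        (fun _ => 1 / L) (fun _ => 1 / Real.sqrt (μ * L)) T x₀ z₀ x z →
      ∀ t : ℝ, 0 ≤ t →
        Integrable (fun ω => f (x t ω)) P ∧
        (∫ ω, f (x t ω) ∂P) - f xstar ≤
          (f x₀ - f xstar + μ / 2 * ‖z₀ - xstar‖ ^ 2) * Real.exp (-Real.sqrt (μ / L) * t)) := by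
  constructor
  · intro hp t ht
    set A : ℝ → ℝ := fun r => r ^ 2 / (4 * L) with hA
    have hAd : ∀ r, HasDerivAt A (r / (2 * L)) r := fun r => by
      convert! ((hasDerivAt_id r).pow 2).div_const (4 * L) using 1
      simp only [id]
      push_cast
      field_simp
      norm_num
    have hder : ∀ s y r, r ≠ 0 → HasDerivAt (fun r => lyapunov f xstar A (fun _ => 1) r
        (decayingFlow s r y)) _ r := fun s y r hr =>
      hasDerivAt_lyapunov hdiff (hasDerivAt_decayingFlow_fst s y hr) (hasDerivAt_const r y.2)
        (hAd r) (hasDerivAt_const r 1)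
    have key := hp.integral_le_of_lyapunov hdiff hmin hT measurable_const (by fun_prop)
      isMixingFlow_decayingFlow (by unfold decayingFlow; fun_prop) (A := A) (B := fun _ => 1)
      (by fun_prop) (by fun_prop) (fun r _ => by positivity) (fun _ _ => zero_le_one)
      ?_ ?_ ?_ ht.le (by positivity)
    · refine ⟨key.1, key.2.trans (le_of_eq ?_)⟩
      simp only [lyapunov, hA]
      field_simp
      ring
    · intro s y hs
      -- at the singular time the flow moves `x`, but the weight `A 0` of `f x` vanishes
      rcases hs.eq_or_lt with rfl | hs0
      · simp [lyapunov, decayingFlow, hA]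
      · simp [decayingFlow, hs0.ne']
    · intro s y hs
      rcases hs.eq_or_lt with rfl | hs0
      · simp only [decayingFlow_zero, lyapunov, hA]
        fun_prop
      · exact fun r hr => (hder s y r (hs0.trans_le hr).ne').continuousAt.continuousWithinAt
    · intro s y hs
      refine ⟨_, fun r hr => ⟨hder s y r (hs.trans_lt hr).ne', ?_⟩⟩
      have hr0 : 0 < r := hs.trans_lt hr
      have h := lyapunov_gradientJump_le (xstar := xstar) (A := A) (B := fun _ => 1)
        (γ' := fun t => t / (2 * L)) (r := r) (η := 2 / r) (η' := 0) (A' := r / (2 * L))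
        (B' := 0) hL hsmooth (by positivity) (by simp only [hA]; field_simp; norm_num)
        (by simp only [hA]; field_simp; norm_num) (decayingFlow s r y).1 (decayingFlow s r y).2 ?_
      · simpa using h
      · have hcv := hconv.add_inner_gradient_le hdiff (decayingFlow s r y).1 xstar
        have hc : A r * (2 / r) = r / (2 * L) := by simp only [hA]; field_simp; norm_num
        rw [hc]
        have := mul_le_mul_of_nonneg_left hcv (show 0 ≤ r / (2 * L) by positivity)
        linarith
  · intro μ hμ hsc hp t ht
    set σ := Real.sqrt (μ / L) with hσ
    have hσγ : μ * (1 / Real.sqrt (μ * L)) = σ := by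
      rw [hσ, Real.sqrt_div hμ.le, Real.sqrt_mul hμ.le]
      have h1 : 0 < Real.sqrt μ := Real.sqrt_pos.2 hμ
      have h2 : 0 < Real.sqrt L := Real.sqrt_pos.2 hL
      field_simp
      exact (Real.sq_sqrt hμ.le).symm
    set A : ℝ → ℝ := fun r => Real.exp (σ * r) with hA
    have hAd : ∀ r, HasDerivAt A (σ * A r) r := fun r => by
      convert! ((hasDerivAt_id r).const_mul σ).exp using 1
      simp [hA, mul_comm]
    have hder : ∀ s y r, HasDerivAt (fun r => lyapunov f xstar A (fun r => μ * A r) r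
        (constantRateFlow σ s r y)) _ r := fun s y r =>
      hasDerivAt_lyapunov hdiff (hasDerivAt_constantRateFlow σ s y r).1
        (hasDerivAt_constantRateFlow σ s y r).2 (hAd r) ((hAd r).const_mul μ)
    have key := hp.integral_le_of_lyapunov hdiff hmin hT measurable_const measurable_const
      (isMixingFlow_constantRateFlow σ) (by unfold constantRateFlow; fun_prop) (A := A)
      (B := fun r => μ * A r) (by fun_prop) (by fun_prop) (fun r _ => (Real.exp_pos _).le)
      (fun r _ => mul_nonneg hμ.le (Real.exp_pos _).le) (fun s y _ => by
        rw [constantRateFlow_self]) (fun s y _ r _ =>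
        (hder s y r).continuousAt.continuousWithinAt) ?_ ht (Real.exp_pos _)
    · refine ⟨key.1, key.2.trans (le_of_eq ?_)⟩
      simp only [lyapunov, hA, neg_mul, Real.exp_neg, mul_zero, Real.exp_zero, mul_one, one_mul]
      rw [div_eq_mul_inv]
    · intro s y hs
      refine ⟨_, fun r hr => ⟨hder s y r, ?_⟩⟩
      have hAr : 0 < A r := Real.exp_pos _
      refine lyapunov_gradientJump_le hL hsmooth hAr.le ?_ ?_
        (constantRateFlow σ s r y).1 (constantRateFlow σ s r y).2 ?_
      · rw [one_div, inv_pow, Real.sq_sqrt (by positivity)]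
        field_simp
      · rw [← hσγ]
        ring
      · generalize (constantRateFlow σ s r y).1 = x
        generalize (constantRateFlow σ s r y).2 = z
        have hs1 := hsc x xstar
        have e : inner ℝ (z - xstar) (x - z)
            = (‖x - xstar‖ ^ 2 - ‖z - xstar‖ ^ 2 - ‖x - z‖ ^ 2) / 2 := by
          have h3 : x - xstar = (z - xstar) + (x - z) := by abel
          rw [h3, norm_add_sq_real]
          ring
        rw [norm_sub_rev] at hs1
        have hk : (f x - f xstar) + inner ℝ (∇ f x) (xstar - x) + μ / 2 * ‖z - xstar‖ ^ 2
            + μ * inner ℝ (z - xstar) (x - z) ≤ 0 := by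
          rw [e]
          nlinarith [mul_nonneg hμ.le (sq_nonneg ‖x - z‖)]
        have hσA : 0 ≤ A r * σ := mul_nonneg hAr.le (Real.sqrt_nonneg _)
        have := mul_le_mul_of_nonneg_left hk hσA
        linarith
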